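/- Let $X$ and $Y$ be classical random variables with finite alphabets and joint distribution $p_{xy}$, let $B$ be a finite-dimensional quantum system, let $\varphi_{xy}^B$ be density operators on $B$, and let $$\psi^{XYB}=\sum_{x,y}p_{xy}\,|x\rangle\langle x|^X\otimes|y\rangle\langle y|^Y\otimes\varphi_{xy}^B .$$ All logarithms are to base $2$, with $\log 0=-\infty$. A compression protocol with $m$ bits for a classical variable $Z$ with quantum side information $S$, applied to a classical-quantum state $\sum_z p_z|z\rangle\langle z|\otimes\varphi_z^S$, consists of an encoder $\mathcal E:\mathcal Z\to\{0,1\}^m$ and, for each $c\in\{0,1\}^m$, a POVM $\{\Lambda_{z;c}\}_z$ on $S$. Its error probability is $1-\sum_z p_z\operatorname{Tr}(\Lambda_{z;\mathcal E(z)}\varphi_z)$. (a) (Two-step compression.) Let $(\mathcal E_1,\Lambda)$ be a compression protocol with $m$ bits for $X$ with side information $B$, with error probability at most $\epsilon_x$ on $\psi^{XB}$. Let $(\mathcal E_2,\Gamma)$ be a compression protocol with $n$ bits for $Y$ with side information $XB$, with error probability at most $\epsilon_y$ on $\psi^{YXB}$. Encode $(x,y)$ as the concatenation of $\mathcal E_1(x)$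 and $\mathcal E_2(y)$. To decode $(c_1,c_2)$, first measure $B$ with Kraus operators $\sqrt{\Lambda_{x;c_1}}$ and store the outcome $x$ in a register, and then measure $\Gamma_{\cdot;c_2}$ on that register together with $B$. The outcome $(x,y)$ thus has POVM element $\sqrt{\Lambda_{x;c_1}}\,\langle x|\Gamma_{y;c_2}|x\rangle\,\sqrt{\Lambda_{x;c_1}}$. This is a compression protocol with $m+n$ bits for $XY$ with side information $B$, and its error probability on $\psi^{XYB}$ is at most $\sqrt{2\epsilon_x}+\epsilon_y$. (b) (Chain rule for smooth max-entropies.) For every $\epsilon>0$, with $\epsilon'=2(\epsilon+\sqrt\epsilon)$, $$H_{\max}^{\epsilon}(X|B)_\psi+H_{\max}^{\epsilon}(Y|XB)_\psi\;\ge\;H_{\max}^{\sqrt{2\epsilon'}}(XY|B)_\psi-4\log\tfrac1\epsilon-8 .$$ Here $H_{\max}(A|B)_\rho=\max_{\sigma^B}2\log F(\rho^{AB},\mathbb 1^A\otimes\sigma^B)$, the maximum being over normalized states $\sigma^B$, with $F(\rho,\sigma)=\|\sqrt\rho\sqrt\sigma\|_1$. Further, $H^{\epsilon}_{\max}(A|B)_\rho=\min_{\bar\rho}H_{\max}(A|B)_{\bar\rho}$,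 the minimum being over all possibly subnormalized states $\bar\rho^{AB}$ with $\sqrt{1-F(\rho,\bar\rho)^2}\le\epsilon$. These entropies take values in $[-\infty,\infty)$; when $\sqrt{2\epsilon'}\ge1$ the right-hand side is $-\infty$. -/

import Mathlib

open scoped ComplexOrder MatrixOrder Kronecker

namespace CQCompression

noncomputable section

/-! ### States, fidelity and purified distance

A finite quantum system is given by a finite type `A` labelling an orthonormal basis; operators on
it are matrices indexed by `A`, and a composite system is labelled by a product type. -/

/-- Density operators (positive, normalized). -/
def IsState {A : Type*} [Fintype A] (ρ : Matrix A A ℂ) : Prop :=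
  ρ.PosSemidef ∧ ρ.trace = 1

/-- Subnormalized states: positive operators of trace at most one. -/
def IsSubState {A : Type*} [Fintype A] (ρ : Matrix A A ℂ) : Prop :=
  ρ.PosSemidef ∧ ρ.trace.re ≤ 1

/-- The trace norm `‖M‖₁ = tr √(M† M)`. -/
def traceNorm {A : Type*} [Fintype A] [DecidableEq A] (M : Matrix A A ℂ) : ℝ :=
  (CFC.sqrt (M.conjTranspose * M)).trace.re

/-- The fidelity `F(ρ, σ) = ‖√ρ √σ‖₁`. -/
def fidelity {A : Type*} [Fintype A] [DecidableEq A] (ρ σ : Matrix A A ℂ) : ℝ :=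
  traceNorm (CFC.sqrt ρ * CFC.sqrt σ)

/-- The purified distance `P(ρ, σ) = √(1 - F(ρ, σ)²)`. -/
def purifiedDist {A : Type*} [Fintype A] [DecidableEq A] (ρ σ : Matrix A A ℂ) : ℝ :=
  Real.sqrt (1 - fidelity ρ σ ^ 2)

/-- The ball of subnormalized states around `ρ` in purified distance. -/
def smoothBall {A : Type*} [Fintype A] [DecidableEq A] (ε : ℝ) (ρ : Matrix A A ℂ) :
    Set (Matrix A A ℂ) :=
  {τ | IsSubState τ ∧ purifiedDist ρ τ ≤ ε}

/-! ### Max-entropies -/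

/-- The binary logarithm of a nonnegative real, with `log 0 = -∞`. -/
def elog2 (x : ℝ) : EReal :=
  if x ≤ 0 then ⊥ else ((Real.logb 2 x : ℝ) : EReal)

/-- The conditional max-entropy `H_max(A|B)_ρ = max_σ 2 log F(ρ, 1 ⊗ σ)`, where `σ` ranges over
the normalized states of `B`. It is `-∞` at `ρ = 0`. -/
def hmax {A B : Type*} [Fintype A] [DecidableEq A] [Fintype B] [DecidableEq B]
    (ρ : Matrix (A × B) (A × B) ℂ) : EReal :=
  ⨆ σ ∈ {σ : Matrix B B ℂ | IsState σ}, 2 * elog2 (fidelity ρ ((1 : Matrix A A ℂ) ⊗ₖ σ))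

/-- The smooth conditional max-entropy `H_max^ε(A|B)_ρ`. -/
def smoothHmax {A B : Type*} [Fintype A] [DecidableEq A] [Fintype B] [DecidableEq B]
    (ε : ℝ) (ρ : Matrix (A × B) (A × B) ℂ) : EReal :=
  ⨅ τ ∈ smoothBall ε ρ, hmax τ

/-! ### Classical-quantum states and their marginals -/

/-- The cq state `∑ₓ pₓ |x⟩⟨x| ⊗ φₓ` of the ensemble `{pₓ, φₓ}`. -/
def cqState {X B : Type*} [Fintype X] [DecidableEq X]
    (p : X → ℝ) (φ : X → Matrix B B ℂ) : Matrix (X × B) (X × B) ℂ :=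
  ∑ x, (p x : ℂ) • (Matrix.single x x (1 : ℂ) ⊗ₖ φ x)

/-- The diagonal block `⟨x| M |x⟩`, an operator on `B`. -/
def block {X B : Type*} (M : Matrix (X × B) (X × B) ℂ) (x : X) : Matrix B B ℂ :=
  Matrix.of fun b b' => M (x, b) (x, b')

/-- The marginal `ψ^{XB} = tr_Y ψ^{XYB}`. -/
def marginalXB {X Y B : Type*} [Fintype Y]
    (ψ : Matrix ((X × Y) × B) ((X × Y) × B) ℂ) : Matrix (X × B) (X × B) ℂ :=
  Matrix.of fun i j => ∑ y, ψ ((i.1, y), i.2) ((j.1, y), j.2)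

/-- The state `ψ^{XYB}` regarded as a state of `Y` together with the side information `XB`. -/
def asYgivenXB {X Y B : Type*}
    (ψ : Matrix ((X × Y) × B) ((X × Y) × B) ℂ) : Matrix (Y × (X × B)) (Y × (X × B)) ℂ :=
  ψ.submatrix (fun i => ((i.2.1, i.1), i.2.2)) (fun i => ((i.2.1, i.1), i.2.2))

/-! ### Compression protocols -/

/-- A decoder of `m`-bit messages with side information `B`: for each message `c` a POVM
`(Λ c x)ₓ` on `B`. -/
def IsDecoder {X B : Type*} [Fintype X] [Fintype B] [DecidableEq B] {m : ℕ}
    (Λ : (Fin m → Bool) → X → Matrix B B ℂ) : Prop :=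
  ∀ c, (∀ x, (Λ c x).PosSemidef) ∧ ∑ x, Λ c x = 1

/-- The average error probability `1 - ∑ₓ pₓ tr (Λ_{x; enc x} φₓ)` of a protocol on the cq state
`ψ` with blocks `⟨x|ψ|x⟩ = pₓ φₓ`. -/
def errorProb {X B : Type*} [Fintype X] [Fintype B] {m : ℕ} (ψ : Matrix (X × B) (X × B) ℂ)
    (enc : X → Fin m → Bool) (Λ : (Fin m → Bool) → X → Matrix B B ℂ) : ℝ :=
  1 - ∑ x, (Λ (enc x) x * block ψ x).trace.re

/-- The encoder of the two-step protocol: `x` and `y` are compressed separately and the two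
bit strings are concatenated. -/
def seqEncoder {X Y : Type*} {m n : ℕ} (encX : X → Fin m → Bool) (encY : Y → Fin n → Bool) :
    X × Y → Fin (m + n) → Bool :=
  fun z => Fin.append (encX z.1) (encY z.2)

/-- The decoder of the two-step protocol: from the first `m` bits, measure `Λ` on `B` with Kraus
operators `√Λₓ` and store the outcome `x` in a register; from the last `n` bits, measure `Γ` on
that register together with `B`. The joint outcome `(x, y)` has the POVM element
`√Λₓ ⟨x|Γ_y|x⟩ √Λₓ`. -/
def seqDecoder {X Y B : Type*} [Fintype B] [DecidableEq B] {m n : ℕ}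
    (Λ : (Fin m → Bool) → X → Matrix B B ℂ)
    (Γ : (Fin n → Bool) → Y → Matrix (X × B) (X × B) ℂ) :
    (Fin (m + n) → Bool) → X × Y → Matrix B B ℂ :=
  fun c z =>
    CFC.sqrt (Λ (fun i => c (Fin.castAdd n i)) z.1) *
      block (Γ (fun j => c (Fin.natAdd m j)) z.2) z.1 *
      CFC.sqrt (Λ (fun i => c (Fin.castAdd n i)) z.1)

end

end CQCompression

/-! Part (a) is gentle measurement. If the correct outcome of the first measurement has probability
at least `1 - δ`, the post-measurement operator `√T ψ √T` has fidelity at least `1 - δ` with `ψ`,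
because `T ≤ √T`. By a Fuchs–van de Graaf inequality, the success probability of the second
measurement then drops by at most `√(2δ)` (`gentle_measurement`).

Part (b) needs no encoder and no hashing: tests `0 ≤ T ≤ 1` replace protocols, and `tr T(1 ⊗ ω)`
plays the role of the message size.

From entropy to tests (`exists_uniform_test`): for each fixed side state `σ`, a Neyman–Pearson test
separates `τ` from a multiple of `1 ⊗ σ` with total error at most their fidelity. Sion's minimax
theorem turns these into one test that works for every `σ`. Passing from the smoothed state back to
the original costs another `ε`, so `H_max^ε < a` gives a test with error at most `2ε` and size at
most `2^a / ε`.

Composition (`smoothHmax_chain_le`): the tests for `X` and for `Y` are combined as in the two-step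
decoder, `q = √t g √t`. Sizes multiply, to at most `2^(a+b) / ε²`, and gentle measurement bounds the
error by `2ε + √(4ε) = ε'`.

From a test to entropy: `√q ψ √q` lies within `√(2ε')` of `ψ`, and by Cauchy–Schwarz its squared
fidelity with `1 ⊗ σ` is at most `∑ tr(q σ)` (`fidelity_one_kronecker_le`). This gives the chain
rule with loss `2 log(1/ε)`, which for `ε < 1` is stronger than the stated one. -/

namespace CQCompression

open Matrix

/-! ### Operator order, traces and functional calculus. -/

section LinearAlgebra

variable {n m : Type*} [Fintype n] [Fintype m]

lemma conjTranspose_mul_self_nonneg (A : Matrix m n ℂ) : 0 ≤ Aᴴ * A :=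
  (posSemidef_conjTranspose_mul_self A).nonneg

lemma self_mul_conjTranspose_nonneg (A : Matrix m n ℂ) : 0 ≤ A * Aᴴ :=
  (posSemidef_self_mul_conjTranspose A).nonneg

lemma conjugate_nonneg {A : Matrix m m ℂ} (hA : 0 ≤ A) (B : Matrix m n ℂ) : 0 ≤ Bᴴ * A * B :=
  (hA.posSemidef.conjTranspose_mul_mul_same B).nonneg

lemma conjugate_le_conjugate {A A' : Matrix m m ℂ} (hA : A ≤ A') (B : Matrix m n ℂ) :
    Bᴴ * A * B ≤ Bᴴ * A' * B := by
  rw [← sub_nonneg, ← Matrix.sub_mul, ← Matrix.mul_sub]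
  exact conjugate_nonneg (sub_nonneg.2 hA) B

lemma trace_re_nonneg {A : Matrix n n ℂ} (hA : 0 ≤ A) : 0 ≤ A.trace.re :=
  (Complex.nonneg_iff.1 hA.posSemidef.trace_nonneg).1

lemma trace_re_mono {A B : Matrix n n ℂ} (h : A ≤ B) : A.trace.re ≤ B.trace.re := by
  have := trace_re_nonneg (sub_nonneg.2 h)
  rw [trace_sub, Complex.sub_re] at this
  linarith

lemma conjTranspose_trace_re (A : Matrix n n ℂ) : (Aᴴ).trace.re = A.trace.re := by
  rw [trace_conjTranspose]; simp

/-- The Cauchy–Schwarz inequality for the Hilbert–Schmidt inner product. -/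
lemma trace_re_le_sqrt_mul_sqrt (A B : Matrix m n ℂ) :
    (Aᴴ * B).trace.re ≤ √(Aᴴ * A).trace.re * √(Bᴴ * B).trace.re := by
  have ha := trace_re_nonneg (conjTranspose_mul_self_nonneg A)
  have hq : ∀ t : ℝ, 0 ≤ (Aᴴ * A).trace.re * (t * t) + (-2 * (Aᴴ * B).trace.re) * t +
      (Bᴴ * B).trace.re := by
    intro t
    have h := trace_re_nonneg (conjTranspose_mul_self_nonneg ((t : ℂ) • A - B))
    have h2 : (Bᴴ * A).trace.re = (Aᴴ * B).trace.re := by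
      rw [← conjTranspose_trace_re, conjTranspose_mul, conjTranspose_conjTranspose]
    simp only [conjTranspose_sub, conjTranspose_smul, Complex.star_def, Complex.conj_ofReal,
      Matrix.sub_mul, Matrix.mul_sub, trace_sub, Matrix.smul_mul, Matrix.mul_smul, trace_smul,
      smul_eq_mul, Complex.sub_re, Complex.re_ofReal_mul, h2] at h
    linarith
  have hd := discrim_le_zero hq
  rw [discrim] at hd
  rw [← Real.sqrt_mul ha]
  apply Real.le_sqrt_of_sq_le
  nlinarith

variable [DecidableEq n]

lemma continuousOn_spectrum (f : ℝ → ℝ) (A : Matrix n n ℂ) : ContinuousOn f (spectrum ℝ A) :=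
  Matrix.finite_real_spectrum.continuousOn f

lemma cfc_mul_cfc (f g : ℝ → ℝ) (A : Matrix n n ℂ) :
    cfc f A * cfc g A = cfc (fun x => f x * g x) A :=
  (cfc_mul f g A (continuousOn_spectrum _ _) (continuousOn_spectrum _ _)).symm

lemma cfc_mul_self (f : ℝ → ℝ) {A : Matrix n n ℂ} (hA : IsSelfAdjoint A) :
    cfc f A * A = cfc (fun x => f x * x) A := by
  rw [← cfc_mul_cfc, cfc_id' ℝ A hA]

lemma self_mul_cfc (f : ℝ → ℝ) {A : Matrix n n ℂ} (hA : IsSelfAdjoint A) :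
    A * cfc f A = cfc (fun x => x * f x) A := by
  rw [← cfc_mul_cfc, cfc_id' ℝ A hA]

lemma sqrt_conjTranspose (A : Matrix n n ℂ) : (CFC.sqrt A)ᴴ = CFC.sqrt A :=
  (CFC.sqrt_nonneg A).isSelfAdjoint

lemma sqrt_mul_sqrt {A : Matrix n n ℂ} (hA : 0 ≤ A) : CFC.sqrt A * CFC.sqrt A = A :=
  CFC.sqrt_mul_sqrt_self A hA

lemma trace_mul_eq_conjugate {B : Matrix n n ℂ} (hB : 0 ≤ B) (A : Matrix n n ℂ) :
    (A * B).trace = ((CFC.sqrt B)ᴴ * A * CFC.sqrt B).trace := by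
  conv_lhs => rw [← sqrt_mul_sqrt hB, ← Matrix.mul_assoc, trace_mul_comm, ← Matrix.mul_assoc]
  rw [sqrt_conjTranspose]

lemma trace_mul_re_nonneg {A B : Matrix n n ℂ} (hA : 0 ≤ A) (hB : 0 ≤ B) :
    0 ≤ (A * B).trace.re := by
  rw [trace_mul_eq_conjugate hB]
  exact trace_re_nonneg (conjugate_nonneg hA _)

lemma trace_mul_re_mono {A A' B : Matrix n n ℂ} (h : A ≤ A') (hB : 0 ≤ B) :
    (A * B).trace.re ≤ (A' * B).trace.re := by
  have := trace_mul_re_nonneg (sub_nonneg.2 h) hB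
  rw [Matrix.sub_mul, trace_sub, Complex.sub_re] at this
  linarith

lemma trace_mul_re_mono_right {A B B' : Matrix n n ℂ} (hA : 0 ≤ A) (h : B ≤ B') :
    (A * B).trace.re ≤ (A * B').trace.re := by
  rw [trace_mul_comm A B, trace_mul_comm A B']
  exact trace_mul_re_mono h hA

/-! ### Contractions, polar decomposition and the trace norm. -/

/-- A contraction. -/
def IsContraction (W : Matrix n n ℂ) : Prop := Wᴴ * W ≤ 1

lemma IsContraction.conjTranspose {W : Matrix n n ℂ} (hW : IsContraction W) :
    IsContraction Wᴴ := by
  -- `1 - W Wᴴ = W (1 - Wᴴ W) Wᴴ + (1 - W Wᴴ)²`, a sum of two positive operators.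
  have h1 := conjugate_nonneg (sub_nonneg.2 hW) Wᴴ
  have h2 := conjTranspose_mul_self_nonneg (1 - W * Wᴴ)
  have h3 := add_nonneg h1 h2
  rw [IsContraction, ← sub_nonneg]
  convert h3 using 1
  simp only [conjTranspose_conjTranspose, conjTranspose_sub, conjTranspose_one, conjTranspose_mul]
  noncomm_ring

lemma IsContraction.mul {V W : Matrix n n ℂ} (hV : IsContraction V) (hW : IsContraction W) :
    IsContraction (V * W) := by
  have h := conjugate_le_conjugate hV W
  rw [Matrix.mul_one] at h
  refine le_trans (le_of_eq ?_) (h.trans hW)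
  simp only [conjTranspose_mul, Matrix.mul_assoc]

/-- The polar decomposition `M = W |M|`. -/
lemma exists_polar (M : Matrix n n ℂ) : ∃ W : Matrix n n ℂ, IsContraction W ∧
    W * CFC.sqrt (Mᴴ * M) = M ∧ Wᴴ * M = CFC.sqrt (Mᴴ * M) := by
  have hP0 := CFC.sqrt_nonneg (Mᴴ * M)
  have hPP := sqrt_mul_sqrt (conjTranspose_mul_self_nonneg M)
  set P := CFC.sqrt (Mᴴ * M)
  -- Since `0⁻¹ = 0`, `J` is the pseudo-inverse of `P = |M|` and `P * J` is its support projection;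
  -- `W = M * J` is a partial isometry, which suffices here in place of a unitary.
  set J := cfc (fun x : ℝ => x⁻¹) P with hJ
  have hJs : Jᴴ = J := (cfc_predicate (R := ℝ) (fun x : ℝ => x⁻¹) P : IsSelfAdjoint J)
  have hPs : Pᴴ = P := hP0.isSelfAdjoint
  have e1 : P * J * P = P := by
    rw [hJ, self_mul_cfc _ hP0.isSelfAdjoint, cfc_mul_self _ hP0.isSelfAdjoint]
    conv_rhs => rw [← cfc_id' ℝ P hP0.isSelfAdjoint]
    congr 1; ext x; by_cases hx : x = 0 <;> simp [hx]
  have e2 : J * P = P * J := by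
    rw [hJ, self_mul_cfc _ hP0.isSelfAdjoint, cfc_mul_self _ hP0.isSelfAdjoint]
    congr 1; ext x; ring
  have e3 : P * J ≤ 1 := by
    rw [hJ, self_mul_cfc _ hP0.isSelfAdjoint]
    exact cfc_le_one _ _ fun x _ => by by_cases hx : x = 0 <;> simp [hx]
  refine ⟨M * J, ?_, ?_, ?_⟩
  · rw [IsContraction, conjTranspose_mul, hJs]
    calc J * Mᴴ * (M * J) = J * (Mᴴ * M) * J := by noncomm_ring
      _ = J * P * P * J := by rw [← hPP]; noncomm_ring
      _ = P * J * P * J := by rw [e2]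
      _ = P * J := by rw [e1]
      _ ≤ 1 := e3
  · rw [eq_comm, ← sub_eq_zero, ← conjTranspose_mul_self_eq_zero]
    simp only [conjTranspose_sub, conjTranspose_mul, hJs, hPs]
    calc (Mᴴ - P * (J * Mᴴ)) * (M - M * J * P)
        = Mᴴ * M - (Mᴴ * M) * J * P - P * J * (Mᴴ * M) + P * J * (Mᴴ * M) * J * P := by
          noncomm_ring
      _ = P * P - P * (P * J * P) - (P * J * P) * P + (P * J * P) * (P * J * P) := by
          rw [← hPP]; noncomm_ring
      _ = 0 := by rw [e1]; noncomm_ring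
  · rw [conjTranspose_mul, hJs, Matrix.mul_assoc, ← hPP, ← Matrix.mul_assoc, e2, e1]

/-- `C + Cᴴ ≤ 2`, because `2 - C - Cᴴ = (1 - C)ᴴ (1 - C) + (1 - Cᴴ C)`. -/
lemma IsContraction.trace_mul_re_le {C : Matrix n n ℂ} (hC : IsContraction C) {P : Matrix n n ℂ}
    (hP : 0 ≤ P) : (C * P).trace.re ≤ P.trace.re := by
  have h1 := conjTranspose_mul_self_nonneg (1 - C)
  have h2 := trace_mul_re_nonneg (add_nonneg h1 (sub_nonneg.2 hC)) hP
  have h3 : (Cᴴ * P).trace.re = (C * P).trace.re := by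
    rw [← conjTranspose_trace_re, conjTranspose_mul, conjTranspose_conjTranspose,
      show Pᴴ = P from hP.isSelfAdjoint, trace_mul_comm]
  have e : (1 - C)ᴴ * (1 - C) + (1 - Cᴴ * C) = (2 : ℂ) • (1 : Matrix n n ℂ) - C - Cᴴ := by
    simp only [conjTranspose_sub, conjTranspose_one, two_smul]
    noncomm_ring
  rw [e] at h2
  simp only [Matrix.sub_mul, Matrix.smul_mul, Matrix.one_mul, trace_sub, trace_smul, smul_eq_mul,
    Complex.sub_re, h3] at h2
  simp at h2
  linarith

/-- Together with the next lemma this is the variational formula: the trace norm is the maximum of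
`Re tr(W M)` over contractions `W`. It replaces singular values below. -/
lemma IsContraction.trace_mul_re_le_traceNorm {W : Matrix n n ℂ} (hW : IsContraction W)
    (M : Matrix n n ℂ) : (W * M).trace.re ≤ traceNorm M := by
  obtain ⟨V, hV, hVM, -⟩ := exists_polar M
  conv_lhs => rw [← hVM, ← Matrix.mul_assoc]
  exact (hW.mul hV).trace_mul_re_le (CFC.sqrt_nonneg _)

lemma exists_trace_mul_re_eq_traceNorm (M : Matrix n n ℂ) :
    ∃ W, IsContraction W ∧ (W * M).trace.re = traceNorm M := by
  obtain ⟨V, hV, -, hVM⟩ := exists_polar M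
  exact ⟨Vᴴ, hV.conjTranspose, by rw [hVM, traceNorm]⟩

lemma isContraction_one : IsContraction (1 : Matrix n n ℂ) := by
  simp [IsContraction]

lemma trace_re_le_traceNorm (M : Matrix n n ℂ) : M.trace.re ≤ traceNorm M := by
  simpa using isContraction_one.trace_mul_re_le_traceNorm M

lemma traceNorm_nonneg (M : Matrix n n ℂ) : 0 ≤ traceNorm M :=
  trace_re_nonneg (CFC.sqrt_nonneg _)

lemma traceNorm_mul_mul_le {V W : Matrix n n ℂ} (hV : IsContraction V) (hW : IsContraction W)
    (M : Matrix n n ℂ) : traceNorm (V * M * W) ≤ traceNorm M := by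
  obtain ⟨U, hU, h⟩ := exists_trace_mul_re_eq_traceNorm (V * M * W)
  rw [← h, ← Matrix.mul_assoc, trace_mul_comm, ← Matrix.mul_assoc, ← Matrix.mul_assoc]
  exact ((hW.mul hU).mul hV).trace_mul_re_le_traceNorm M

lemma traceNorm_conjTranspose_mul_le (A B : Matrix n n ℂ) :
    traceNorm (Aᴴ * B) ≤ √(Aᴴ * A).trace.re * √(Bᴴ * B).trace.re := by
  obtain ⟨U, hU, h⟩ := exists_trace_mul_re_eq_traceNorm (Aᴴ * B)
  have h1 := trace_re_le_sqrt_mul_sqrt (A * Uᴴ) B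
  rw [conjTranspose_mul, conjTranspose_conjTranspose, Matrix.mul_assoc, h] at h1
  refine h1.trans (mul_le_mul_of_nonneg_right (Real.sqrt_le_sqrt ?_) (Real.sqrt_nonneg _))
  have h2 := trace_mul_re_mono hU (conjTranspose_mul_self_nonneg A)
  rw [Matrix.one_mul] at h2
  refine le_trans (le_of_eq ?_) h2
  rw [← Matrix.mul_assoc, trace_mul_comm]
  simp only [Matrix.mul_assoc]

/-! ### Fidelity and its operational bounds. -/

/-- `S` and `√(S Sᴴ)` agree up to contractions. -/
lemma exists_sqrt_self_mul_conjTranspose (S : Matrix n n ℂ) : ∃ V, IsContraction V ∧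
    S * V = CFC.sqrt (S * Sᴴ) ∧ CFC.sqrt (S * Sᴴ) * Vᴴ = S := by
  obtain ⟨W, hW, h1, h2⟩ := exists_polar Sᴴ
  rw [conjTranspose_conjTranspose] at h1 h2
  refine ⟨W, hW, ?_, ?_⟩
  · have := congrArg Matrix.conjTranspose h2
    rwa [conjTranspose_mul, conjTranspose_conjTranspose, conjTranspose_conjTranspose,
      sqrt_conjTranspose] at this
  · have := congrArg Matrix.conjTranspose h1
    rwa [conjTranspose_mul, conjTranspose_conjTranspose, sqrt_conjTranspose] at this

/-- Any factorizations may replace the positive square roots, as contractions on either side cannot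
increase the trace norm. This makes fidelities of post-measurement operators computable. -/
lemma fidelity_self_mul_conjTranspose (S T : Matrix n n ℂ) :
    fidelity (S * Sᴴ) (T * Tᴴ) = traceNorm (Sᴴ * T) := by
  obtain ⟨V, hV, hV1, hV2⟩ := exists_sqrt_self_mul_conjTranspose S
  obtain ⟨W, hW, hW1, hW2⟩ := exists_sqrt_self_mul_conjTranspose T
  apply le_antisymm
  · rw [fidelity, ← sqrt_conjTranspose (S * Sᴴ), ← hV1, ← hW1, conjTranspose_mul]
    have := traceNorm_mul_mul_le hV.conjTranspose hW (Sᴴ * T)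
    simpa only [Matrix.mul_assoc] using this
  · conv_lhs => rw [← hV2, ← hW2, conjTranspose_mul, sqrt_conjTranspose,
      conjTranspose_conjTranspose]
    have := traceNorm_mul_mul_le hV hW.conjTranspose (CFC.sqrt (S * Sᴴ) * CFC.sqrt (T * Tᴴ))
    simpa only [fidelity, Matrix.mul_assoc] using this

lemma fidelity_nonneg (A B : Matrix n n ℂ) : 0 ≤ fidelity A B := traceNorm_nonneg _

lemma fidelity_self {A : Matrix n n ℂ} (hA : 0 ≤ A) : fidelity A A = A.trace.re := by
  rw [fidelity, sqrt_mul_sqrt hA, traceNorm, show Aᴴ = A from hA.isSelfAdjoint,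
    CFC.sqrt_mul_self A hA]

lemma fidelity_le {A B : Matrix n n ℂ} (hA : 0 ≤ A) (hB : 0 ≤ B) :
    fidelity A B ≤ √A.trace.re * √B.trace.re := by
  have := traceNorm_conjTranspose_mul_le (CFC.sqrt A) (CFC.sqrt B)
  rwa [sqrt_conjTranspose, sqrt_conjTranspose, sqrt_mul_sqrt hA, sqrt_mul_sqrt hB] at this

/-- Put `a = cos² α`, `b = cos² β`. The hypothesis reads `f ≤ cos(α - β)`, while `(a - b)² = sin²(α
- β) sin²(α + β) ≤ sin²(α - β)`. -/
lemma abs_sub_sq_add_fidelity_sq_le {a b f : ℝ} (ha0 : 0 ≤ a) (ha1 : a ≤ 1) (hb0 : 0 ≤ b)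
    (hb1 : b ≤ 1) (hf0 : 0 ≤ f) (hf : f ≤ √a * √b + √(1 - a) * √(1 - b)) :
    (a - b) ^ 2 ≤ 1 - f ^ 2 := by
  have h1 := Real.sq_sqrt ha0
  have h2 := Real.sq_sqrt hb0
  have h3 := Real.sq_sqrt (sub_nonneg.2 ha1)
  have h4 := Real.sq_sqrt (sub_nonneg.2 hb1)
  have p1 := Real.sqrt_nonneg a
  have p2 := Real.sqrt_nonneg b
  have p3 := Real.sqrt_nonneg (1 - a)
  have p4 := Real.sqrt_nonneg (1 - b)
  set u := √a
  set v := √b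
  set s := √(1 - a)
  set t := √(1 - b)
  have hff : f ^ 2 ≤ (u * v + s * t) ^ 2 := pow_le_pow_left₀ hf0 hf 2
  have e1 : (u * v + s * t) ^ 2 + (u * t - v * s) ^ 2 = 1 := by
    have : (u * v + s * t) ^ 2 + (u * t - v * s) ^ 2 = (u ^ 2 + s ^ 2) * (v ^ 2 + t ^ 2) := by ring
    rw [this, h1, h2, h3, h4]; ring
  have e2 : (u * t + v * s) ^ 2 + (u * v - s * t) ^ 2 = 1 := by
    have : (u * t + v * s) ^ 2 + (u * v - s * t) ^ 2 = (u ^ 2 + s ^ 2) * (v ^ 2 + t ^ 2) := by ring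
    rw [this, h1, h2, h3, h4]; ring
  have e3 : a - b = (u * t - v * s) * (u * t + v * s) := by
    have : (u * t - v * s) * (u * t + v * s) = u ^ 2 * t ^ 2 - v ^ 2 * s ^ 2 := by ring
    rw [this, h1, h2, h3, h4]; ring
  have e4 : (u * t + v * s) ^ 2 ≤ 1 := by nlinarith [sq_nonneg (u * v - s * t)]
  rw [e3, mul_pow]
  nlinarith [mul_le_mul_of_nonneg_left e4 (sq_nonneg (u * t - v * s))]

lemma trace_conjTranspose_mul_mul_re_le {E : Matrix n n ℂ} (hE : 0 ≤ E) (R S : Matrix n n ℂ) :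
    (Rᴴ * E * S).trace.re ≤ √(E * (R * Rᴴ)).trace.re * √(E * (S * Sᴴ)).trace.re := by
  have h := trace_re_le_sqrt_mul_sqrt (CFC.sqrt E * R) (CFC.sqrt E * S)
  have key : ∀ A B : Matrix n n ℂ, (CFC.sqrt E * A)ᴴ * (CFC.sqrt E * B) = Aᴴ * E * B := by
    intro A B
    conv_rhs => rw [← sqrt_mul_sqrt hE]
    simp only [conjTranspose_mul, sqrt_conjTranspose, Matrix.mul_assoc]
  have key2 : ∀ A : Matrix n n ℂ, (Aᴴ * E * A).trace = (E * (A * Aᴴ)).trace := by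
    intro A
    rw [Matrix.mul_assoc, trace_mul_comm, Matrix.mul_assoc]
  rwa [key, key, key, key2, key2] at h

/-- Fuchs–van de Graaf inequality for a test `E`, in terms of purifications. -/
lemma trace_mul_sub_le_of_overlap {E R S : Matrix n n ℂ} (hE0 : 0 ≤ E) (hE1 : E ≤ 1)
    (hR : (R * Rᴴ).trace.re = 1) (hS : (S * Sᴴ).trace.re ≤ 1) {f : ℝ} (hf0 : 0 ≤ f)
    (hf : f ≤ (Rᴴ * S).trace.re) :
    (E * (R * Rᴴ)).trace.re - (E * (S * Sᴴ)).trace.re ≤ √(1 - f ^ 2) := by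
  have hE' := sub_nonneg.2 hE1
  have h1 := trace_conjTranspose_mul_mul_re_le hE0 R S
  have h2 := trace_conjTranspose_mul_mul_re_le hE' R S
  have hR0 := self_mul_conjTranspose_nonneg R
  have hS0 := self_mul_conjTranspose_nonneg S
  have a0 := trace_mul_re_nonneg hE0 hR0
  have b0 := trace_mul_re_nonneg hE0 hS0
  have a1 := trace_mul_re_nonneg hE' hR0
  have b1 := trace_mul_re_nonneg hE' hS0
  have e1 : ((1 - E) * (R * Rᴴ)).trace.re = 1 - (E * (R * Rᴴ)).trace.re := by
    rw [Matrix.sub_mul, trace_sub, Complex.sub_re, Matrix.one_mul, hR]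
  have e2 : ((1 - E) * (S * Sᴴ)).trace.re ≤ 1 - (E * (S * Sᴴ)).trace.re := by
    rw [Matrix.sub_mul, trace_sub, Complex.sub_re, Matrix.one_mul]
    linarith
  have e3 : (Rᴴ * S).trace.re = (Rᴴ * E * S).trace.re + (Rᴴ * (1 - E) * S).trace.re := by
    rw [← Complex.add_re, ← trace_add]; congr 2; noncomm_ring
  apply Real.le_sqrt_of_sq_le
  refine abs_sub_sq_add_fidelity_sq_le a0 (by linarith) b0 (by linarith) hf0 ?_
  rw [e1] at h2
  have h3 := mul_le_mul_of_nonneg_left (Real.sqrt_le_sqrt e2)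
    (Real.sqrt_nonneg (1 - (E * (R * Rᴴ)).trace.re))
  linarith

lemma trace_mul_sub_le_of_fidelity {E A B : Matrix n n ℂ} (hE0 : 0 ≤ E) (hE1 : E ≤ 1)
    (hA : 0 ≤ A) (hA1 : A.trace.re = 1) (hB : 0 ≤ B) (hB1 : B.trace.re ≤ 1) :
    (E * A).trace.re - (E * B).trace.re ≤ purifiedDist A B := by
  -- Uhlmann's choice: `S = √B W` has overlap with `√A` exactly equal to the fidelity. As `W` is
  -- only a contraction, `S Sᴴ ≤ B` rather than equality, which is the harmless direction.
  obtain ⟨W, hW, h⟩ := exists_trace_mul_re_eq_traceNorm (CFC.sqrt A * CFC.sqrt B)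
  have hRR : CFC.sqrt A * (CFC.sqrt A)ᴴ = A := by rw [sqrt_conjTranspose, sqrt_mul_sqrt hA]
  have hSS : (CFC.sqrt B * W) * (CFC.sqrt B * W)ᴴ ≤ B := by
    have h1 := hW.conjTranspose
    rw [IsContraction, conjTranspose_conjTranspose] at h1
    have := conjugate_le_conjugate h1 (CFC.sqrt B)
    rw [Matrix.mul_one, sqrt_conjTranspose, sqrt_mul_sqrt hB] at this
    simpa only [conjTranspose_mul, sqrt_conjTranspose, Matrix.mul_assoc] using this
  have := trace_mul_sub_le_of_overlap (R := CFC.sqrt A) (S := CFC.sqrt B * W) hE0 hE1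
    (by rw [hRR, hA1]) ((trace_re_mono hSS).trans hB1) (fidelity_nonneg A B)
    (by rw [fidelity, ← h, trace_mul_comm W, sqrt_conjTranspose, Matrix.mul_assoc])
  rw [hRR] at this
  have h2 := trace_mul_re_mono_right hE0 hSS
  rw [purifiedDist]
  linarith

/-- A quantum Neyman–Pearson bound, from the argument behind the Powers–Størmer inequality. -/
lemma exists_test_le_fidelity {A B : Matrix n n ℂ} (hA : 0 ≤ A) (hB : 0 ≤ B) :
    ∃ T : Matrix n n ℂ, 0 ≤ T ∧ T ≤ 1 ∧
      ((1 - T) * A).trace.re + (T * B).trace.re ≤ fidelity A B := by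
  have ha := CFC.sqrt_nonneg A
  have hb := CFC.sqrt_nonneg B
  have haa := sqrt_mul_sqrt hA
  have hbb := sqrt_mul_sqrt hB
  have htr := trace_re_le_traceNorm (CFC.sqrt A * CFC.sqrt B)
  rw [fidelity]
  set a := CFC.sqrt A
  set b := CFC.sqrt B
  have hD : IsSelfAdjoint (a - b) := ha.isSelfAdjoint.sub hb.isSelfAdjoint
  set D := a - b with hDdef
  set T := cfc (fun x : ℝ => if 0 < x then 1 else 0) D with hT
  set K := cfc (fun x : ℝ => max x 0) D with hK
  set N := cfc (fun x : ℝ => max (-x) 0) D with hN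
  have hK0 : 0 ≤ K := cfc_nonneg fun x _ => le_max_right _ _
  have hN0 : 0 ≤ N := cfc_nonneg fun x _ => le_max_right _ _
  have hTD : T * D = K := by
    rw [hT, hK, cfc_mul_self _ hD]
    congr 1; ext x
    by_cases hx : 0 < x
    · simp [hx, hx.le]
    · simp [hx, not_lt.1 hx]
  have hDT : D * T = K := by
    rw [hT, hK, self_mul_cfc _ hD]
    congr 1; ext x
    by_cases hx : 0 < x
    · simp [hx, hx.le]
    · simp [hx, not_lt.1 hx]
  have hKN : D = K - N := by
    conv_lhs => rw [← cfc_id' ℝ D hD]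
    rw [hK, hN, ← cfc_sub _ _ _ (continuousOn_spectrum _ _) (continuousOn_spectrum _ _)]
    congr 1; ext x
    rcases le_total x 0 with hx | hx <;> simp [hx]
  refine ⟨T, cfc_nonneg fun x _ => by split_ifs <;> norm_num,
    cfc_le_one _ _ fun x _ => by split_ifs <;> norm_num, ?_⟩
  -- With `T` the projection onto the positive part of `D = a - b`, and `K`, `N` the positive and
  -- negative parts, the total error equals `tr(a b) - tr(N a) - tr(K b)`, hence is at most `tr(a
  -- b)`.
  have h1 : (T * (a * a)).trace - (T * (b * b)).trace = (K * a).trace + (K * b).trace := by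
    have e : T * (a * a) - T * (b * b) = T * D * a + T * (b * D) := by rw [hDdef]; noncomm_ring
    rw [← trace_sub, e, trace_add, hTD, trace_mul_comm T, Matrix.mul_assoc, hDT, trace_mul_comm b]
  have h2 : (a * a).trace - (a * b).trace = (K * a).trace - (N * a).trace := by
    rw [← trace_sub, ← trace_sub, ← Matrix.mul_sub, ← Matrix.sub_mul, ← hKN, trace_mul_comm]
  have h3 := trace_mul_re_nonneg hK0 hb
  have h4 := trace_mul_re_nonneg hN0 ha
  have h1' := congrArg Complex.re h1
  have h2' := congrArg Complex.re h2
  simp only [Complex.sub_re, Complex.add_re] at h1' h2'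
  rw [← haa, ← hbb, Matrix.sub_mul, trace_sub, Complex.sub_re, Matrix.one_mul]
  linarith

end LinearAlgebra

/-! ### Convexity and compactness of tests and states; scaling of the fidelity. -/

section Tests

variable {n : Type*}

lemma smul_add_smul_nonneg {A B : Matrix n n ℂ} (hA : 0 ≤ A) (hB : 0 ≤ B) {a b : ℝ} (ha : 0 ≤ a)
    (hb : 0 ≤ b) : 0 ≤ a • A + b • B :=
  add_nonneg (hA.posSemidef.smul ha).nonneg (hB.posSemidef.smul hb).nonneg

lemma convex_tests [DecidableEq n] : Convex ℝ {T : Matrix n n ℂ | 0 ≤ T ∧ T ≤ 1} := by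
  rintro S ⟨hS0, hS1⟩ T ⟨hT0, hT1⟩ a b ha hb hab
  refine ⟨smul_add_smul_nonneg hS0 hT0 ha hb, ?_⟩
  have h := smul_add_smul_nonneg (sub_nonneg.2 hS1) (sub_nonneg.2 hT1) ha hb
  rw [← sub_nonneg]
  convert h using 1
  rw [smul_sub, smul_sub, sub_add_sub_comm, ← add_smul, hab, one_smul]

lemma convex_setOf_isState [Fintype n] : Convex ℝ {σ : Matrix n n ℂ | IsState σ} := by
  rintro S ⟨hS0, hS1⟩ T ⟨hT0, hT1⟩ a b ha hb hab
  refine ⟨(smul_add_smul_nonneg hS0.nonneg hT0.nonneg ha hb).posSemidef, ?_⟩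
  rw [trace_add, trace_smul, trace_smul, hS1, hT1, ← add_smul, hab, one_smul]

variable [Fintype n] [DecidableEq n]

lemma sqrt_le_one {T : Matrix n n ℂ} (h0 : 0 ≤ T) (h1 : T ≤ 1) : CFC.sqrt T ≤ 1 := by
  have hs := sqrt_mul_sqrt h0
  have e : (1 - CFC.sqrt T)ᴴ * (1 - CFC.sqrt T) + (1 - T) = (2 : ℂ) • (1 - CFC.sqrt T) := by
    rw [conjTranspose_sub, conjTranspose_one, sqrt_conjTranspose, two_smul]
    nth_rewrite 3 [← hs]
    noncomm_ring
  have h := add_nonneg (conjTranspose_mul_self_nonneg (1 - CFC.sqrt T)) (sub_nonneg.2 h1)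
  rw [e] at h
  have h2 := (h.posSemidef.smul (a := (2⁻¹ : ℂ)) (by simp)).nonneg
  rw [smul_smul, inv_mul_cancel₀ two_ne_zero, one_smul] at h2
  exact sub_nonneg.1 h2

/-- `√T - T = r (1 - √T) r` with `r` the fourth root of `T`. -/
lemma le_sqrt {T : Matrix n n ℂ} (h0 : 0 ≤ T) (h1 : T ≤ 1) : T ≤ CFC.sqrt T := by
  have hs := sqrt_mul_sqrt h0
  have hr := sqrt_mul_sqrt (CFC.sqrt_nonneg T)
  have h := conjugate_nonneg (sub_nonneg.2 (sqrt_le_one h0 h1)) (CFC.sqrt (CFC.sqrt T))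
  rw [sqrt_conjTranspose] at h
  rw [← sub_nonneg]
  convert h using 1
  generalize CFC.sqrt (CFC.sqrt T) = r at hr ⊢
  calc CFC.sqrt T - T = r * r - (r * r) * (r * r) := by rw [hr, hs]
    _ = r * (1 - r * r) * r := by noncomm_ring
    _ = r * (1 - CFC.sqrt T) * r := by rw [hr]

/-- The set is the image of a closed Hilbert–Schmidt ball under `R ↦ Rᴴ R`; the ball is compact
because its entries are bounded by `√c`. -/
lemma isCompact_nonneg_trace_le (c : ℝ) :
    IsCompact {A : Matrix n n ℂ | 0 ≤ A ∧ A.trace.re ≤ c} := by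
  have htr : ∀ R : Matrix n n ℂ, (Rᴴ * R).trace.re = ∑ i, ∑ j, ‖R j i‖ ^ 2 := by
    intro R
    simp only [trace, diag_apply, mul_apply, conjTranspose_apply, Complex.re_sum]
    refine Finset.sum_congr rfl fun i _ => Finset.sum_congr rfl fun j _ => ?_
    rw [Complex.star_def, ← Complex.normSq_eq_conj_mul_self, Complex.ofReal_re,
      Complex.normSq_eq_norm_sq]
  have hbox : IsCompact {R : Matrix n n ℂ | ∀ i j, R i j ∈ Metric.closedBall (0 : ℂ) √c} := by
    have : IsCompact (Set.univ.pi fun _ : n => Set.univ.pi fun _ : n =>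
        Metric.closedBall (0 : ℂ) √c) :=
      isCompact_univ_pi fun _ => isCompact_univ_pi fun _ => isCompact_closedBall _ _
    simp only [Set.pi, Set.mem_univ, true_imp_iff] at this
    exact this
  have hcont : Continuous fun R : Matrix n n ℂ => Rᴴ * R :=
    (continuous_id.matrix_conjTranspose).matrix_mul continuous_id
  have hK : IsCompact {R : Matrix n n ℂ | (Rᴴ * R).trace.re ≤ c} := by
    refine hbox.of_isClosed_subset
      (isClosed_le (Complex.continuous_re.comp hcont.matrix_trace) continuous_const) ?_
    intro R hR i j
    rw [mem_closedBall_zero_iff]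
    apply Real.le_sqrt_of_sq_le
    rw [Set.mem_ofPred_eq, htr] at hR
    refine le_trans ?_ hR
    refine le_trans ?_ (Finset.single_le_sum (f := fun j => ∑ i, ‖R i j‖ ^ 2)
      (fun _ _ => by positivity) (Finset.mem_univ j))
    exact Finset.single_le_sum (f := fun i => ‖R i j‖ ^ 2)
      (fun _ _ => by positivity) (Finset.mem_univ i)
  convert hK.image hcont using 1
  ext A
  constructor
  · rintro ⟨hA, hc⟩
    have e : (CFC.sqrt A)ᴴ * CFC.sqrt A = A := by rw [sqrt_conjTranspose, sqrt_mul_sqrt hA]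
    exact ⟨CFC.sqrt A, by rwa [Set.mem_ofPred_eq, e], e⟩
  · rintro ⟨R, hR, rfl⟩
    exact ⟨conjTranspose_mul_self_nonneg R, hR⟩

lemma isCompact_setOf_isState : IsCompact {σ : Matrix n n ℂ | IsState σ} := by
  have h := (isCompact_nonneg_trace_le (n := n) 1).inter_right
    (isClosed_eq (continuous_id.matrix_trace) continuous_const :
      IsClosed {σ : Matrix n n ℂ | σ.trace = 1})
  convert h using 1
  ext σ
  constructor
  · rintro ⟨h0, h1⟩
    exact ⟨⟨h0.nonneg, by rw [h1, Complex.one_re]⟩, h1⟩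
  · rintro ⟨⟨h0, -⟩, h1⟩
    exact ⟨h0.posSemidef, h1⟩

lemma isCompact_tests : IsCompact {T : Matrix n n ℂ | 0 ≤ T ∧ T ≤ 1} := by
  have hK := isCompact_nonneg_trace_le (n := n) (1 : Matrix n n ℂ).trace.re
  have h2 := hK.inter_right (hK.isClosed.preimage
    (continuous_const.sub continuous_id : Continuous fun T : Matrix n n ℂ => 1 - T))
  convert h2 using 1
  ext T
  constructor
  · rintro ⟨h0, h1⟩
    exact ⟨⟨h0, trace_re_mono h1⟩, sub_nonneg.2 h1, trace_re_mono (sub_le_self _ h0)⟩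
  · rintro ⟨⟨h0, -⟩, h1, -⟩
    exact ⟨h0, sub_nonneg.1 h1⟩

lemma exists_isState [Nonempty n] : ∃ σ : Matrix n n ℂ, IsState σ := by
  obtain ⟨i⟩ := ‹Nonempty n›
  refine ⟨(single i i 1)ᴴ * single i i 1, (conjTranspose_mul_self_nonneg _).posSemidef, ?_⟩
  simp [conjTranspose_single]

lemma traceNorm_smul_le {t : ℝ} (ht : 0 ≤ t) (M : Matrix n n ℂ) :
    traceNorm ((t : ℂ) • M) ≤ t * traceNorm M := by
  obtain ⟨W, hW, h⟩ := exists_trace_mul_re_eq_traceNorm ((t : ℂ) • M)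
  rw [← h, Matrix.mul_smul, trace_smul, smul_eq_mul, Complex.re_ofReal_mul]
  exact mul_le_mul_of_nonneg_left (hW.trace_mul_re_le_traceNorm M) ht

lemma fidelity_smul_le {t : ℝ} (ht : 0 ≤ t) {A B : Matrix n n ℂ} (hA : 0 ≤ A) (hB : 0 ≤ B) :
    fidelity A (((t ^ 2 : ℝ) : ℂ) • B) ≤ t * fidelity A B := by
  have h := traceNorm_smul_le ht (CFC.sqrt A * CFC.sqrt B)
  have h2 := fidelity_self_mul_conjTranspose (CFC.sqrt A) ((t : ℂ) • CFC.sqrt B)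
  rw [conjTranspose_smul, sqrt_conjTranspose, sqrt_conjTranspose, sqrt_mul_sqrt hA,
    Complex.star_def, Complex.conj_ofReal, Matrix.smul_mul, Matrix.mul_smul, smul_smul,
    sqrt_mul_sqrt hB, Matrix.mul_smul] at h2
  rw [fidelity, ← pow_two] at *
  rw [Complex.ofReal_pow, h2]
  exact h

lemma purifiedDist_le_of_le_fidelity {A B : Matrix n n ℂ} {δ : ℝ} (h : 1 - δ ≤ fidelity A B) :
    purifiedDist A B ≤ √(2 * δ) := by
  apply Real.sqrt_le_sqrt
  -- For `δ > 1` the hypothesis cannot be squared, but then `1 - F² ≤ 1 ≤ 2δ`.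
  rcases le_total δ 1 with hδ | hδ
  · nlinarith [sq_nonneg δ]
  · nlinarith [sq_nonneg (fidelity A B)]

lemma purifiedDist_le_one (A B : Matrix n n ℂ) : purifiedDist A B ≤ 1 := by
  rw [purifiedDist, Real.sqrt_le_iff]
  constructor <;> linarith [sq_nonneg (fidelity A B)]

lemma purifiedDist_self {A : Matrix n n ℂ} (hA : IsState A) : purifiedDist A A = 0 := by
  rw [purifiedDist, fidelity_self hA.1.nonneg, hA.2]
  simp

end Tests

/-! ### Classical-quantum operators and gentle measurement. -/

section BlockDiagonal

variable {Z B : Type*}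

/-- The block diagonal operator `∑ z, |z⟩⟨z| ⊗ M z`. -/
def cqOp [DecidableEq Z] (M : Z → Matrix B B ℂ) : Matrix (Z × B) (Z × B) ℂ :=
  Matrix.of fun i j => if i.1 = j.1 then M i.1 i.2 j.2 else 0

lemma block_sub (M N : Matrix (Z × B) (Z × B) ℂ) (z : Z) :
    block (M - N) z = block M z - block N z := rfl

lemma block_sum {ι : Type*} (s : Finset ι) (M : ι → Matrix (Z × B) (Z × B) ℂ) (z : Z) :
    block (∑ i ∈ s, M i) z = ∑ i ∈ s, block (M i) z := by
  ext b b'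
  simp [block, Matrix.sum_apply]

lemma block_nonneg {M : Matrix (Z × B) (Z × B) ℂ} (hM : 0 ≤ M) (z : Z) : 0 ≤ block M z :=
  (hM.posSemidef.submatrix fun b => (z, b)).nonneg

variable [DecidableEq Z]

lemma block_one [DecidableEq B] (z : Z) : block (1 : Matrix (Z × B) (Z × B) ℂ) z = 1 := by
  ext b b'
  simp [block, Matrix.one_apply]

lemma block_le_one [DecidableEq B] {M : Matrix (Z × B) (Z × B) ℂ} (hM : M ≤ 1) (z : Z) :
    block M z ≤ 1 := by
  have := block_nonneg (sub_nonneg.2 hM) z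
  rwa [block_sub, block_one, sub_nonneg] at this

lemma block_cqOp (M : Z → Matrix B B ℂ) (z : Z) : block (cqOp M) z = M z := by
  ext b b'
  simp [block, cqOp]

lemma cqOp_one [DecidableEq B] : cqOp (fun _ : Z => (1 : Matrix B B ℂ)) = 1 := by
  ext ⟨z, b⟩ ⟨z', b'⟩
  by_cases h : z = z' <;> simp [cqOp, Matrix.one_apply, h]

lemma cqOp_sub (M N : Z → Matrix B B ℂ) : cqOp (fun z => M z - N z) = cqOp M - cqOp N := by
  ext ⟨z, b⟩ ⟨z', b'⟩
  by_cases h : z = z' <;> simp [cqOp, h]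

lemma cqOp_conjTranspose (M : Z → Matrix B B ℂ) : (cqOp M)ᴴ = cqOp fun z => (M z)ᴴ := by
  ext ⟨z, b⟩ ⟨z', b'⟩
  by_cases h : z = z'
  · subst h; simp [cqOp]
  · simp [cqOp, h, Ne.symm h]

lemma one_kronecker_eq_cqOp (σ : Matrix B B ℂ) :
    (1 : Matrix Z Z ℂ) ⊗ₖ σ = cqOp fun _ => σ := by
  ext ⟨z, b⟩ ⟨z', b'⟩
  by_cases h : z = z' <;> simp [cqOp, h]

variable [Fintype Z]

lemma cqState_eq_cqOp (p : Z → ℝ) (φ : Z → Matrix B B ℂ) :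
    cqState p φ = cqOp fun z => (p z : ℂ) • φ z := by
  ext ⟨z, b⟩ ⟨z', b'⟩
  by_cases h : z = z'
  · subst h
    simp [cqState, cqOp, Matrix.sum_apply, Matrix.single_apply]
  · simp only [cqState, cqOp, Matrix.sum_apply, Matrix.smul_apply, kronecker_apply, of_apply,
      if_neg h]
    refine Finset.sum_eq_zero fun x _ => ?_
    rw [Matrix.single_apply, if_neg (by rintro ⟨rfl, rfl⟩; exact h rfl)]
    simp

variable [Fintype B]

lemma cqOp_mul (M N : Z → Matrix B B ℂ) : cqOp M * cqOp N = cqOp fun z => M z * N z := by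
  ext ⟨z, b⟩ ⟨z', b'⟩
  by_cases h : z = z'
  · subst h; simp [cqOp, Matrix.mul_apply, Fintype.sum_prod_type]
  · simp [cqOp, Matrix.mul_apply, Fintype.sum_prod_type, h]

lemma trace_cqOp_mul (M : Z → Matrix B B ℂ) (N : Matrix (Z × B) (Z × B) ℂ) :
    (cqOp M * N).trace = ∑ z, (M z * block N z).trace := by
  simp [cqOp, block, Matrix.trace, Matrix.mul_apply, Fintype.sum_prod_type]

lemma trace_cqOp (M : Z → Matrix B B ℂ) : (cqOp M).trace = ∑ z, (M z).trace := by
  simp [cqOp, Matrix.trace, Fintype.sum_prod_type]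

lemma trace_mul_one_kronecker (T : Matrix (Z × B) (Z × B) ℂ) (ω : Matrix B B ℂ) :
    (T * ((1 : Matrix Z Z ℂ) ⊗ₖ ω)).trace = ∑ z, (block T z * ω).trace := by
  rw [one_kronecker_eq_cqOp, trace_mul_comm, trace_cqOp_mul]
  exact Finset.sum_congr rfl fun z _ => trace_mul_comm _ _

variable [DecidableEq B]

lemma cqOp_nonneg {M : Z → Matrix B B ℂ} (hM : ∀ z, 0 ≤ M z) : 0 ≤ cqOp M := by
  have h : cqOp M = (cqOp fun z => CFC.sqrt (M z))ᴴ * cqOp fun z => CFC.sqrt (M z) := by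
    rw [cqOp_conjTranspose, cqOp_mul]
    simp only [sqrt_conjTranspose, sqrt_mul_sqrt (hM _)]
  rw [h]
  exact conjTranspose_mul_self_nonneg _

lemma cqOp_le_one {M : Z → Matrix B B ℂ} (hM : ∀ z, M z ≤ 1) : cqOp M ≤ 1 := by
  rw [← sub_nonneg, ← cqOp_one, ← cqOp_sub]
  exact cqOp_nonneg fun z => sub_nonneg.2 (hM z)

lemma one_kronecker_nonneg {σ : Matrix B B ℂ} (hσ : 0 ≤ σ) : 0 ≤ (1 : Matrix Z Z ℂ) ⊗ₖ σ := by
  rw [one_kronecker_eq_cqOp]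
  exact cqOp_nonneg fun _ => hσ

lemma trace_sqrt_mul_mul_sqrt_mul {T : Matrix B B ℂ} (G ψ : Matrix B B ℂ) :
    (CFC.sqrt T * G * CFC.sqrt T * ψ).trace = (G * (CFC.sqrt T * ψ * CFC.sqrt T)).trace := by
  rw [Matrix.mul_assoc, Matrix.mul_assoc, trace_mul_comm]
  simp only [Matrix.mul_assoc]

lemma cqOp_sqrt_mul_conjTranspose {ψ : Z → Matrix B B ℂ} (hψ : ∀ z, 0 ≤ ψ z)
    (T : Z → Matrix B B ℂ) :
    cqOp (fun z => CFC.sqrt (T z) * CFC.sqrt (ψ z)) *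
        (cqOp fun z => CFC.sqrt (T z) * CFC.sqrt (ψ z))ᴴ =
      cqOp fun z => CFC.sqrt (T z) * ψ z * CFC.sqrt (T z) := by
  rw [cqOp_conjTranspose, cqOp_mul]
  congr 1; ext1 z
  conv_rhs => rw [← sqrt_mul_sqrt (hψ z)]
  simp only [conjTranspose_mul, sqrt_conjTranspose, Matrix.mul_assoc]

lemma cqOp_sqrt_mul_conjTranspose_self {ψ : Z → Matrix B B ℂ} (hψ : ∀ z, 0 ≤ ψ z) :
    cqOp (fun z => CFC.sqrt (ψ z)) * (cqOp fun z => CFC.sqrt (ψ z))ᴴ = cqOp ψ := by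
  rw [cqOp_conjTranspose, cqOp_mul]
  simp only [sqrt_conjTranspose, sqrt_mul_sqrt (hψ _)]

/-- The factors `√ψ` and `√T √ψ` have overlap `tr(√T ψ)`, which dominates `tr(T ψ)` since `T ≤ √T`.
-/
lemma sum_trace_le_fidelity {ψ T : Z → Matrix B B ℂ} (hψ : ∀ z, 0 ≤ ψ z) (hT0 : ∀ z, 0 ≤ T z)
    (hT1 : ∀ z, T z ≤ 1) :
    ∑ z, (T z * ψ z).trace.re ≤
      fidelity (cqOp ψ) (cqOp fun z => CFC.sqrt (T z) * ψ z * CFC.sqrt (T z)) := by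
  rw [← cqOp_sqrt_mul_conjTranspose_self hψ, ← cqOp_sqrt_mul_conjTranspose hψ,
    fidelity_self_mul_conjTranspose]
  refine le_trans ?_ (trace_re_le_traceNorm _)
  rw [cqOp_conjTranspose, cqOp_mul, trace_cqOp, Complex.re_sum]
  refine Finset.sum_le_sum fun z _ => ?_
  rw [sqrt_conjTranspose, trace_mul_comm (CFC.sqrt (ψ z)), Matrix.mul_assoc,
    sqrt_mul_sqrt (hψ z)]
  exact trace_mul_re_mono (le_sqrt (hT0 z) (hT1 z)) (hψ z)

/-- The fidelity is the trace norm of `√ψ √T √σ`; Cauchy–Schwarz splits it between `√ψ` and `√T √σ`.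
This converts the size of a test into a max-entropy bound. -/
lemma fidelity_one_kronecker_le {ψ T : Z → Matrix B B ℂ} (hψ : ∀ z, 0 ≤ ψ z)
    (hT0 : ∀ z, 0 ≤ T z) {σ : Matrix B B ℂ} (hσ : 0 ≤ σ) :
    fidelity (cqOp fun z => CFC.sqrt (T z) * ψ z * CFC.sqrt (T z)) ((1 : Matrix Z Z ℂ) ⊗ₖ σ) ≤
      √(∑ z, (ψ z).trace.re) * √(∑ z, (T z * σ).trace.re) := by
  rw [one_kronecker_eq_cqOp, ← cqOp_sqrt_mul_conjTranspose_self fun _ : Z => hσ,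
    ← cqOp_sqrt_mul_conjTranspose hψ, fidelity_self_mul_conjTranspose]
  have h := traceNorm_conjTranspose_mul_le (cqOp fun z => CFC.sqrt (ψ z))
    (cqOp fun z => CFC.sqrt (T z) * CFC.sqrt σ)
  simp only [cqOp_conjTranspose, cqOp_mul, conjTranspose_mul, sqrt_conjTranspose, trace_cqOp,
    Complex.re_sum, sqrt_mul_sqrt (hψ _), Matrix.mul_assoc] at h ⊢
  refine h.trans (le_of_eq ?_)
  congr 2
  refine Finset.sum_congr rfl fun z _ => ?_
  rw [← Matrix.mul_assoc (CFC.sqrt (T z)), sqrt_mul_sqrt (hT0 z), trace_mul_comm,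
    Matrix.mul_assoc, sqrt_mul_sqrt hσ]

lemma cqOp_sqrt_mul_mul_sqrt_nonneg {ψ : Z → Matrix B B ℂ} (hψ : ∀ z, 0 ≤ ψ z)
    (T : Z → Matrix B B ℂ) : 0 ≤ cqOp fun z => CFC.sqrt (T z) * ψ z * CFC.sqrt (T z) := by
  rw [← cqOp_sqrt_mul_conjTranspose hψ]
  exact self_mul_conjTranspose_nonneg _

lemma trace_cqOp_sqrt_mul_mul_sqrt_le {ψ T : Z → Matrix B B ℂ} (hψ : ∀ z, 0 ≤ ψ z)
    (hT0 : ∀ z, 0 ≤ T z) (hT1 : ∀ z, T z ≤ 1) :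
    (cqOp fun z => CFC.sqrt (T z) * ψ z * CFC.sqrt (T z)).trace.re ≤ ∑ z, (ψ z).trace.re := by
  rw [trace_cqOp, Complex.re_sum]
  refine Finset.sum_le_sum fun z _ => ?_
  rw [trace_mul_comm, ← Matrix.mul_assoc, sqrt_mul_sqrt (hT0 z)]
  simpa using trace_mul_re_mono (hT1 z) (hψ z)

/-- The gentle measurement lemma for ensembles: a likely outcome of `T` barely disturbs the
outcome `G` of a subsequent measurement. -/
lemma gentle_measurement {ψ T G : Z → Matrix B B ℂ} (hψ : ∀ z, 0 ≤ ψ z)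
    (hψ1 : ∑ z, (ψ z).trace.re = 1) (hT0 : ∀ z, 0 ≤ T z) (hT1 : ∀ z, T z ≤ 1)
    (hG0 : ∀ z, 0 ≤ G z) (hG1 : ∀ z, G z ≤ 1) {δ η : ℝ}
    (hδ : 1 - δ ≤ ∑ z, (T z * ψ z).trace.re) (hη : 1 - η ≤ ∑ z, (G z * ψ z).trace.re) :
    1 - (√(2 * δ) + η) ≤ ∑ z, (CFC.sqrt (T z) * G z * CFC.sqrt (T z) * ψ z).trace.re := by
  have h := trace_mul_sub_le_of_fidelity (cqOp_nonneg hG0) (cqOp_le_one hG1) (cqOp_nonneg hψ)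
    (by rw [trace_cqOp, Complex.re_sum, hψ1]) (cqOp_sqrt_mul_mul_sqrt_nonneg hψ T)
    ((trace_cqOp_sqrt_mul_mul_sqrt_le hψ hT0 hT1).trans hψ1.le)
  have h2 := purifiedDist_le_of_le_fidelity (hδ.trans (sum_trace_le_fidelity hψ hT0 hT1))
  rw [trace_cqOp_mul, trace_cqOp_mul, Complex.re_sum, Complex.re_sum] at h
  simp only [block_cqOp, ← trace_sqrt_mul_mul_sqrt_mul] at h
  linarith

end BlockDiagonal

/-! ### From max-entropy to a test uniform in the side state. -/

section Minimax

variable {A B : Type*} [Fintype A] [DecidableEq A] [Fintype B] [DecidableEq B]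

/-- Uniform tests from a bound on the max-entropy, by the minimax theorem. -/
lemma exists_uniform_test [Nonempty B] {τ : Matrix (A × B) (A × B) ℂ} (hτ : 0 ≤ τ) {f ε : ℝ}
    (hf : 0 < f) (hε : 0 < ε)
    (h : ∀ σ : Matrix B B ℂ, IsState σ → fidelity τ ((1 : Matrix A A ℂ) ⊗ₖ σ) ≤ f) :
    ∃ T : Matrix (A × B) (A × B) ℂ, 0 ≤ T ∧ T ≤ 1 ∧ ((1 - T) * τ).trace.re ≤ ε ∧
      ∀ ω : Matrix B B ℂ, 0 ≤ ω →
        (T * ((1 : Matrix A A ℂ) ⊗ₖ ω)).trace.re ≤ f ^ 2 / ε * ω.trace.re := by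
  -- This weight makes `F(τ, t² (1 ⊗ σ)) ≤ t f = ε`, so the minimax value of `g` is at most `ε`; the
  -- size bound is then `ε / t² = f² / ε`.
  set t := ε / f with ht
  have ht0 : 0 < t := div_pos hε hf
  let g : Matrix (A × B) (A × B) ℂ → Matrix B B ℂ → ℝ := fun T σ =>
    ((1 - T) * τ).trace.re + t ^ 2 * ∑ a, (block T a * σ).trace.re
  have hgk : ∀ T σ, g T σ = ((1 - T) * τ).trace.re +
      t ^ 2 * (T * ((1 : Matrix A A ℂ) ⊗ₖ σ)).trace.re := fun T σ => by
    simp only [g, trace_mul_one_kronecker, Complex.re_sum]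
  have hblock : ∀ a : A, Continuous fun T : Matrix (A × B) (A × B) ℂ => block T a := fun a =>
    continuous_id.matrix_submatrix (fun b => (a, b)) (fun b => (a, b))
  have hcT : ∀ σ, Continuous fun T => g T σ := fun σ =>
    (Complex.continuous_re.comp ((continuous_const.sub continuous_id).matrix_mul
      continuous_const).matrix_trace).add (continuous_const.mul (continuous_finsetSum _ fun a _ =>
        Complex.continuous_re.comp ((hblock a).matrix_mul continuous_const).matrix_trace))
  have hcσ : ∀ T, Continuous fun σ => g T σ := fun T =>
    continuous_const.add (continuous_const.mul (continuous_finsetSum _ fun a _ =>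
      Complex.continuous_re.comp (continuous_const.matrix_mul continuous_id).matrix_trace))
  have haT : ∀ σ S T (a b : ℝ), a + b = 1 → g (a • S + b • T) σ = a * g S σ + b * g T σ := by
    intro σ S T a b hab
    simp only [hgk, Matrix.sub_mul, Matrix.add_mul, Matrix.smul_mul, trace_sub, trace_add,
      trace_smul, Matrix.one_mul, Complex.add_re, Complex.sub_re, Complex.smul_re, smul_eq_mul]
    linear_combination (-(τ.trace.re)) * hab
  have haσ : ∀ T σ ω (a b : ℝ), a + b = 1 → g T (a • σ + b • ω) = a * g T σ + b * g T ω := by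
    intro T σ ω a b hab
    simp only [g, Matrix.mul_add, Matrix.mul_smul, trace_add,
      trace_smul, Complex.add_re, Complex.smul_re, smul_eq_mul, Finset.sum_add_distrib,
      ← Finset.mul_sum]
    linear_combination (-(((1 - T) * τ).trace.re)) * hab
  obtain ⟨T, hT, σ₀, hσ₀, hsaddle⟩ := Sion.exists_isSaddlePointOn
    (X := {T : Matrix (A × B) (A × B) ℂ | 0 ≤ T ∧ T ≤ 1}) (Y := {σ : Matrix B B ℂ | IsState σ})
    (f := g) ⟨0, le_rfl, (PosSemidef.one).nonneg⟩ convex_tests isCompact_tests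
    (fun σ _ => (hcT σ).lowerSemicontinuous.lowerSemicontinuousOn _)
    (fun σ _ => ConvexOn.quasiconvexOn ⟨convex_tests, fun S _ T _ a b _ _ hab =>
      (haT σ S T a b hab).le⟩)
    convex_setOf_isState exists_isState isCompact_setOf_isState
    (fun T _ => (hcσ T).upperSemicontinuous.upperSemicontinuousOn _)
    (fun T _ => ConcaveOn.quasiconcaveOn ⟨convex_setOf_isState, fun σ _ ω _ a b _ _ hab =>
      (haσ T σ ω a b hab).ge⟩)
  have hkey : ∀ σ : Matrix B B ℂ, IsState σ → g T σ ≤ ε := by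
    intro σ hσ
    have hk := one_kronecker_nonneg (Z := A) hσ₀.1.nonneg
    have hk' : 0 ≤ ((t ^ 2 : ℝ) : ℂ) • ((1 : Matrix A A ℂ) ⊗ₖ σ₀) :=
      (hk.posSemidef.smul (by exact_mod_cast (sq_nonneg t))).nonneg
    -- The saddle point gives `g T σ ≤ g S σ₀` for every test `S`; the Neyman–Pearson test against
    -- `σ₀` makes the right side at most `ε`.
    obtain ⟨S, hS0, hS1, hS⟩ := exists_test_le_fidelity hτ hk'
    refine (hsaddle S ⟨hS0, hS1⟩ σ hσ).trans ?_
    rw [Matrix.mul_smul, trace_smul, smul_eq_mul, Complex.re_ofReal_mul, ← hgk] at hS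
    refine hS.trans ((fidelity_smul_le ht0.le hτ hk).trans ?_)
    refine (mul_le_mul_of_nonneg_left (h σ₀ hσ₀) ht0.le).trans (le_of_eq ?_)
    rw [ht]; field_simp
  have hnn : ∀ σ : Matrix B B ℂ, 0 ≤ σ → 0 ≤ (T * ((1 : Matrix A A ℂ) ⊗ₖ σ)).trace.re :=
    fun σ hσ => trace_mul_re_nonneg hT.1 (one_kronecker_nonneg hσ)
  have hnn' : 0 ≤ ((1 - T) * τ).trace.re := trace_mul_re_nonneg (sub_nonneg.2 hT.2) hτ
  refine ⟨T, hT.1, hT.2, ?_, fun ω hω => ?_⟩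
  · have h1 := hkey σ₀ hσ₀
    rw [hgk] at h1
    nlinarith [mul_nonneg (sq_nonneg t) (hnn σ₀ hσ₀.1.nonneg)]
  · have hstate : ∀ σ : Matrix B B ℂ, IsState σ →
        (T * ((1 : Matrix A A ℂ) ⊗ₖ σ)).trace.re ≤ f ^ 2 / ε := by
      intro σ hσ
      have h1 := hkey σ hσ
      rw [hgk] at h1
      have h2 : t ^ 2 * (T * ((1 : Matrix A A ℂ) ⊗ₖ σ)).trace.re ≤ ε := by linarith
      rw [← le_div_iff₀' (by positivity)] at h2
      refine h2.trans (le_of_eq ?_)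
      rw [ht]; field_simp
    have htr := Complex.nonneg_iff.1 hω.posSemidef.trace_nonneg
    have htr' : (ω.trace.re : ℂ) = ω.trace := Complex.ext rfl htr.2
    -- Homogeneity extends the bound from states to all positive `ω`; the composition of tests needs
    -- it for an unnormalized `ω`.
    rcases htr.1.eq_or_lt with h0 | h0
    · have : ω = 0 := hω.posSemidef.trace_eq_zero_iff.1 (by rw [← htr', ← h0]; rfl)
      subst this
      simp
    · have h3 := hstate (((ω.trace.re)⁻¹ : ℝ) • ω)
        ⟨hω.posSemidef.smul (inv_nonneg.2 h0.le), by
          rw [trace_smul, Complex.real_smul, ← htr', Complex.ofReal_re, ← Complex.ofReal_mul,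
            inv_mul_cancel₀ h0.ne', Complex.ofReal_one]⟩
      rw [kronecker_smul, Matrix.mul_smul, trace_smul, Complex.smul_re, smul_eq_mul,
        inv_mul_le_iff₀ h0] at h3
      linarith

end Minimax

/-! ### Max-entropy bounds as fidelity bounds, and smoothing. -/

section MaxEntropy

variable {A B : Type*} [Fintype A] [DecidableEq A] [Fintype B] [DecidableEq B]

lemma two_mul_elog2_le_iff {x c : ℝ} : 2 * elog2 x ≤ (c : EReal) ↔ x ≤ 2 ^ (c / 2) := by
  rw [elog2]
  split_ifs with hx
  · have h2 : (2 : EReal) * ⊥ = ⊥ := EReal.coe_mul_bot_of_pos (x := 2) two_pos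
    rw [h2]
    exact iff_of_true bot_le (hx.trans (by positivity))
  · have h2 : (2 : EReal) * ((Real.logb 2 x : ℝ) : EReal) = ((2 * Real.logb 2 x : ℝ) : EReal) := by
      rw [EReal.coe_mul]; rfl
    rw [h2, EReal.coe_le_coe_iff, ← le_div_iff₀' two_pos,
      Real.logb_le_iff_le_rpow one_lt_two (not_le.1 hx)]

lemma hmax_le_iff {τ : Matrix (A × B) (A × B) ℂ} {c : ℝ} :
    hmax τ ≤ (c : EReal) ↔
      ∀ σ : Matrix B B ℂ, IsState σ → fidelity τ ((1 : Matrix A A ℂ) ⊗ₖ σ) ≤ 2 ^ (c / 2) := by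
  simp only [hmax, iSup₂_le_iff, two_mul_elog2_le_iff, Set.mem_ofPred_eq]

lemma hmax_lt_top {τ : Matrix (A × B) (A × B) ℂ} (hτ : 0 ≤ τ) : hmax τ < ⊤ := by
  set K := √τ.trace.re * √(Fintype.card A : ℝ)
  have hK : 0 < max K 1 := lt_max_of_lt_right one_pos
  refine lt_of_le_of_lt (hmax_le_iff (c := 2 * Real.logb 2 (max K 1)) |>.2 fun σ hσ => ?_)
    (EReal.coe_lt_top _)
  rw [mul_div_cancel_left₀ _ (two_ne_zero' ℝ), Real.rpow_logb two_pos (by norm_num) hK]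
  refine le_trans ?_ (le_max_left _ _)
  have h := fidelity_le hτ (one_kronecker_nonneg (Z := A) hσ.1.nonneg)
  rwa [trace_kronecker, hσ.2, trace_one, mul_one, Complex.natCast_re] at h

/-- Excludes `⊤ + ⊥` when the two entropies of the chain rule are added in `EReal`. -/
lemma smoothHmax_lt_top {ρ : Matrix (A × B) (A × B) ℂ} (hρ : IsState ρ) {ε : ℝ} (hε : 0 ≤ ε) :
    smoothHmax ε ρ < ⊤ :=
  (iInf₂_le ρ ⟨⟨hρ.1, by rw [hρ.2, Complex.one_re]⟩, (purifiedDist_self hρ).trans_le hε⟩).trans_lt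
    (hmax_lt_top hρ.1.nonneg)

/-- The ball of radius at least one contains the zero operator, whose max-entropy is `⊥`. -/
lemma smoothHmax_eq_bot (ρ : Matrix (A × B) (A × B) ℂ) {ε : ℝ} (hε : 1 ≤ ε) :
    smoothHmax ε ρ = ⊥ := by
  have h0 : (0 : Matrix (A × B) (A × B) ℂ) ∈ smoothBall ε ρ :=
    ⟨⟨PosSemidef.zero, by simp⟩, (purifiedDist_le_one _ _).trans hε⟩
  refine eq_bot_iff.2 ((iInf₂_le _ h0).trans (iSup₂_le fun σ hσ => ?_))
  have h := fidelity_le (le_refl (0 : Matrix (A × B) (A × B) ℂ))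
    (one_kronecker_nonneg (Z := A) hσ.1.nonneg)
  rw [trace_zero, Complex.zero_re, Real.sqrt_zero, zero_mul] at h
  rw [elog2, if_pos h]
  exact (EReal.coe_mul_bot_of_pos (x := 2) two_pos).le

/-- Tests for a state that is close to a state of bounded max-entropy. -/
lemma exists_uniform_test_of_smoothHmax_lt [Nonempty B] {ρ : Matrix (A × B) (A × B) ℂ}
    (hρ : IsState ρ) {ε a : ℝ} (hε : 0 < ε) (h : smoothHmax ε ρ < (a : EReal)) :
    ∃ T : Matrix (A × B) (A × B) ℂ, 0 ≤ T ∧ T ≤ 1 ∧ 1 - 2 * ε ≤ (T * ρ).trace.re ∧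
      ∀ ω : Matrix B B ℂ, 0 ≤ ω →
        (T * ((1 : Matrix A A ℂ) ⊗ₖ ω)).trace.re ≤ 2 ^ a / ε * ω.trace.re := by
  simp only [smoothHmax, iInf_lt_iff, exists_prop] at h
  obtain ⟨τ, ⟨⟨hτ0, hτ1⟩, hτ⟩, hlt⟩ := h
  obtain ⟨T, hT0, hT1, hT, hTω⟩ := exists_uniform_test hτ0.nonneg
    (Real.rpow_pos_of_pos two_pos (a / 2)) hε (hmax_le_iff.1 hlt.le)
  refine ⟨T, hT0, hT1, ?_, ?_⟩
  -- One `ε` is the error of the test on the smoothed state `τ`, the other the purified distance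
  -- from `ρ` to `τ`.
  · have h1 := trace_mul_sub_le_of_fidelity (sub_nonneg.2 hT1) (sub_le_self 1 hT0) hρ.1.nonneg
      (by rw [hρ.2, Complex.one_re]) hτ0.nonneg hτ1
    rw [Matrix.sub_mul 1 T ρ, trace_sub, Complex.sub_re, Matrix.one_mul, hρ.2,
      Complex.one_re] at h1
    linarith
  · rwa [← Real.rpow_natCast, ← Real.rpow_mul two_pos.le, Nat.cast_ofNat,
      div_mul_cancel₀ a two_ne_zero] at hTω

end MaxEntropy

/-! ### The two-step protocol and the chain rule. -/

section Bipartite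

variable {X Y B : Type*} [DecidableEq X] [DecidableEq Y]

lemma asYgivenXB_cqOp (M : X × Y → Matrix B B ℂ) :
    asYgivenXB (cqOp M) = cqOp fun y => cqOp fun x => M (x, y) := by
  ext ⟨y, x, b⟩ ⟨y', x', b'⟩
  by_cases h : x = x' <;> by_cases h' : y = y' <;> simp [asYgivenXB, cqOp, h, h']

variable [Fintype Y]

lemma marginalXB_cqOp (M : X × Y → Matrix B B ℂ) :
    marginalXB (cqOp M) = cqOp fun x => ∑ y, M (x, y) := by
  ext ⟨x, b⟩ ⟨x', b'⟩
  by_cases h : x = x' <;> simp [marginalXB, cqOp, h, Matrix.sum_apply]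

variable [Fintype X] [Fintype B]

lemma sum_trace_mul_marginalXB (M : X × Y → Matrix B B ℂ) (T : X → Matrix B B ℂ) :
    ∑ x, (T x * block (marginalXB (cqOp M)) x).trace.re =
      ∑ z : X × Y, (T z.1 * M z).trace.re := by
  rw [marginalXB_cqOp, Fintype.sum_prod_type]
  simp only [block_cqOp, Matrix.mul_sum, trace_sum, Complex.re_sum]

lemma sum_trace_mul_asYgivenXB (M : X × Y → Matrix B B ℂ)
    (G : Y → Matrix (X × B) (X × B) ℂ) :
    ∑ y, (G y * block (asYgivenXB (cqOp M)) y).trace.re =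
      ∑ z : X × Y, (block (G z.2) z.1 * M z).trace.re := by
  rw [asYgivenXB_cqOp, Fintype.sum_prod_type_right]
  refine Finset.sum_congr rfl fun y _ => ?_
  rw [block_cqOp, trace_mul_comm, trace_cqOp_mul, Complex.re_sum]
  exact Finset.sum_congr rfl fun x _ => by rw [trace_mul_comm]

lemma trace_marginalXB (M : X × Y → Matrix B B ℂ) :
    (marginalXB (cqOp M)).trace = ∑ z, (M z).trace := by
  rw [marginalXB_cqOp, trace_cqOp, Fintype.sum_prod_type]
  simp only [trace_sum]

lemma trace_asYgivenXB (M : X × Y → Matrix B B ℂ) :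
    (asYgivenXB (cqOp M)).trace = ∑ z, (M z).trace := by
  rw [asYgivenXB_cqOp, trace_cqOp, Fintype.sum_prod_type_right]
  simp only [trace_cqOp]

variable [DecidableEq B]

omit [DecidableEq X] in
lemma IsDecoder.nonneg {m : ℕ} {Λ : (Fin m → Bool) → X → Matrix B B ℂ} (h : IsDecoder Λ)
    (c : Fin m → Bool) (x : X) : 0 ≤ Λ c x := ((h c).1 x).nonneg

omit [DecidableEq X] in
lemma IsDecoder.le_one {m : ℕ} {Λ : (Fin m → Bool) → X → Matrix B B ℂ} (h : IsDecoder Λ)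
    (c : Fin m → Bool) (x : X) : Λ c x ≤ 1 := by
  rw [← (h c).2]
  exact Finset.single_le_sum (fun x _ => h.nonneg c x) (Finset.mem_univ x)

omit [DecidableEq Y] in
lemma isDecoder_seqDecoder {m n : ℕ} {Λ : (Fin m → Bool) → X → Matrix B B ℂ}
    {Γ : (Fin n → Bool) → Y → Matrix (X × B) (X × B) ℂ} (hΛ : IsDecoder Λ) (hΓ : IsDecoder Γ) :
    IsDecoder (seqDecoder Λ Γ) := by
  intro c
  refine ⟨fun z => ?_, ?_⟩
  · have h := conjugate_nonneg (block_nonneg (hΓ.nonneg (fun j => c (Fin.natAdd m j)) z.2) z.1)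
      (CFC.sqrt (Λ (fun i => c (Fin.castAdd n i)) z.1))
    rw [sqrt_conjTranspose] at h
    exact h.posSemidef
  · simp only [seqDecoder, Fintype.sum_prod_type, ← Matrix.sum_mul, ← Matrix.mul_sum, ← block_sum,
      (hΓ _).2, block_one, Matrix.mul_one, sqrt_mul_sqrt (hΛ.nonneg _ _), (hΛ _).2]

lemma errorProb_seqDecoder_le {m n : ℕ} {M : X × Y → Matrix B B ℂ} (hM : ∀ z, 0 ≤ M z)
    (hM1 : ∑ z, (M z).trace.re = 1) (encX : X → Fin m → Bool) (encY : Y → Fin n → Bool)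
    {Λ : (Fin m → Bool) → X → Matrix B B ℂ}
    {Γ : (Fin n → Bool) → Y → Matrix (X × B) (X × B) ℂ} {δ η : ℝ} (hΛ : IsDecoder Λ)
    (hΓ : IsDecoder Γ) (hδ : errorProb (marginalXB (cqOp M)) encX Λ ≤ δ)
    (hη : errorProb (asYgivenXB (cqOp M)) encY Γ ≤ η) :
    errorProb (cqOp M) (seqEncoder encX encY) (seqDecoder Λ Γ) ≤ √(2 * δ) + η := by
  rw [errorProb, sum_trace_mul_marginalXB M fun x => Λ (encX x) x] at hδ
  rw [errorProb, sum_trace_mul_asYgivenXB M fun y => Γ (encY y) y] at hη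
  -- The success probability involves only the POVM elements of the correct outcomes, so for each
  -- `z` both measurements reduce to a single effect.
  have h := gentle_measurement (T := fun z : X × Y => Λ (encX z.1) z.1)
    (G := fun z : X × Y => block (Γ (encY z.2) z.2) z.1) hM hM1 (fun z => hΛ.nonneg _ _)
    (fun z => hΛ.le_one _ _) (fun z => block_nonneg (hΓ.nonneg _ _) _)
    (fun z => block_le_one (hΓ.le_one _ _) _) (sub_le_comm.1 hδ) (sub_le_comm.1 hη)
  rw [errorProb, sub_le_comm]
  simpa only [seqDecoder, seqEncoder, Fin.append_left, Fin.append_right, block_cqOp] using h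

lemma isState_marginalXB {M : X × Y → Matrix B B ℂ} (hM : ∀ z, 0 ≤ M z)
    (hM1 : ∑ z, (M z).trace = 1) : IsState (marginalXB (cqOp M)) := by
  refine ⟨?_, by rw [trace_marginalXB, hM1]⟩
  rw [marginalXB_cqOp]
  exact (cqOp_nonneg fun x => Finset.sum_nonneg fun y _ => hM (x, y)).posSemidef

lemma isState_asYgivenXB {M : X × Y → Matrix B B ℂ} (hM : ∀ z, 0 ≤ M z)
    (hM1 : ∑ z, (M z).trace = 1) : IsState (asYgivenXB (cqOp M)) := by
  refine ⟨?_, by rw [trace_asYgivenXB, hM1]⟩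
  rw [asYgivenXB_cqOp]
  exact (cqOp_nonneg fun y => cqOp_nonneg fun x => hM (x, y)).posSemidef

/-- The tests for `X` given `B` and for `Y` given `XB` are composed like the measurements of the
two-step decoder, and the resulting `√q M √q` is the smoothed state. -/
lemma smoothHmax_chain_le [Nonempty X] [Nonempty B] {M : X × Y → Matrix B B ℂ}
    (hM : ∀ z, 0 ≤ M z) (hM1 : ∑ z, (M z).trace = 1) {ε a b : ℝ} (hε : 0 < ε)
    (ha : smoothHmax ε (marginalXB (cqOp M)) < (a : EReal))
    (hb : smoothHmax ε (asYgivenXB (cqOp M)) < (b : EReal)) :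
    smoothHmax √(2 * (2 * (ε + √ε))) (cqOp M) ≤
      ((a + b + 2 * Real.logb 2 (1 / ε) : ℝ) : EReal) := by
  have hX := isState_marginalXB hM hM1
  have hY := isState_asYgivenXB hM hM1
  have hM1' : ∑ z, (M z).trace.re = 1 := by rw [← Complex.re_sum, hM1, Complex.one_re]
  obtain ⟨T, hT0, hT1, hT, hTω⟩ := exists_uniform_test_of_smoothHmax_lt hX hε ha
  obtain ⟨G, hG0, hG1, hG, hGω⟩ := exists_uniform_test_of_smoothHmax_lt hY hε hb
  -- The states are block diagonal, so only the diagonal blocks of `T` and `G` matter.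
  set t : X × Y → Matrix B B ℂ := fun z => block T z.1 with ht
  set g : X × Y → Matrix B B ℂ := fun z => block (block G z.2) z.1 with hg
  have ht0 : ∀ z, 0 ≤ t z := fun z => block_nonneg hT0 _
  have ht1 : ∀ z, t z ≤ 1 := fun z => block_le_one hT1 _
  have hg0 : ∀ z, 0 ≤ g z := fun z => block_nonneg (block_nonneg hG0 _) _
  have hg1 : ∀ z, g z ≤ 1 := fun z => block_le_one (block_le_one hG1 _) _
  have htM : 1 - 2 * ε ≤ ∑ z, (t z * M z).trace.re := by
    rw [← sum_trace_mul_marginalXB M (block T)]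
    rw [marginalXB_cqOp, trace_mul_comm, trace_cqOp_mul, Complex.re_sum] at hT
    rw [marginalXB_cqOp]
    simp only [block_cqOp]
    exact hT.trans_eq (Finset.sum_congr rfl fun x _ => by rw [trace_mul_comm])
  have hgM : 1 - 2 * ε ≤ ∑ z, (g z * M z).trace.re := by
    rw [← sum_trace_mul_asYgivenXB M (block G)]
    rw [asYgivenXB_cqOp, trace_mul_comm, trace_cqOp_mul, Complex.re_sum] at hG
    rw [asYgivenXB_cqOp]
    simp only [block_cqOp]
    exact hG.trans_eq (Finset.sum_congr rfl fun x _ => by rw [trace_mul_comm])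
  set q : X × Y → Matrix B B ℂ := fun z => CFC.sqrt (t z) * g z * CFC.sqrt (t z) with hq
  have hq0 : ∀ z, 0 ≤ q z := fun z => by
    simpa only [sqrt_conjTranspose] using conjugate_nonneg (hg0 z) (CFC.sqrt (t z))
  have hq1 : ∀ z, q z ≤ 1 := fun z => by
    have h := conjugate_le_conjugate (hg1 z) (CFC.sqrt (t z))
    rw [sqrt_conjTranspose, Matrix.mul_one, sqrt_mul_sqrt (ht0 z)] at h
    exact h.trans (ht1 z)
  have hqM := gentle_measurement hM hM1' ht0 ht1 hg0 hg1 htM hgM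
  have hball : cqOp (fun z => CFC.sqrt (q z) * M z * CFC.sqrt (q z)) ∈
      smoothBall √(2 * (2 * (ε + √ε))) (cqOp M) := by
    refine ⟨⟨(cqOp_sqrt_mul_mul_sqrt_nonneg hM q).posSemidef,
      (trace_cqOp_sqrt_mul_mul_sqrt_le hM hq0 hq1).trans hM1'.le⟩, ?_⟩
    apply purifiedDist_le_of_le_fidelity
    refine le_trans ?_ (sum_trace_le_fidelity hM hq0 hq1)
    refine le_trans (le_of_eq ?_) hqM
    -- Gentle measurement with both errors `2ε` gives `√(4ε) + 2ε = 2(ε + √ε)`.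
    rw [← mul_assoc, Real.sqrt_mul (by norm_num),
      show (2 * 2 : ℝ) = 2 ^ 2 by norm_num, Real.sqrt_sq two_pos.le]
    ring
  refine (iInf₂_le _ hball).trans (hmax_le_iff.2 fun σ hσ => ?_)
  refine (fidelity_one_kronecker_le hM hq0 hσ.1.nonneg).trans ?_
  rw [hM1', Real.sqrt_one, one_mul]
  -- `ω` is what the first test makes of `σ`, with `x` kept in a register. The size of `q` at `σ` is
  -- that of `G` at `ω`, and `tr ω` is the size of `T` at `σ`; so the two bounds multiply.
  set ω : Matrix (X × B) (X × B) ℂ :=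
    cqOp fun x => CFC.sqrt (block T x) * σ * CFC.sqrt (block T x) with hω
  have hω0 : 0 ≤ ω := cqOp_sqrt_mul_mul_sqrt_nonneg (fun _ => hσ.1.nonneg) _
  have h1 : ∑ z, (q z * σ).trace.re = (G * ((1 : Matrix Y Y ℂ) ⊗ₖ ω)).trace.re := by
    rw [trace_mul_one_kronecker, Complex.re_sum, Fintype.sum_prod_type_right]
    refine Finset.sum_congr rfl fun y _ => ?_
    rw [trace_mul_comm, hω, trace_cqOp_mul, Complex.re_sum]
    refine Finset.sum_congr rfl fun x _ => ?_
    rw [hq, trace_sqrt_mul_mul_sqrt_mul, trace_mul_comm]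
  have h2 : ω.trace.re = (T * ((1 : Matrix X X ℂ) ⊗ₖ σ)).trace.re := by
    rw [trace_mul_one_kronecker, hω, trace_cqOp]
    congr 1
    refine Finset.sum_congr rfl fun x _ => ?_
    rw [trace_mul_comm, ← Matrix.mul_assoc, sqrt_mul_sqrt (block_nonneg hT0 x)]
  have h3 := hGω ω hω0
  have h4 := hTω σ hσ.1.nonneg
  rw [hσ.2, Complex.one_re, mul_one, ← h2] at h4
  have h5 : ∑ z, (q z * σ).trace.re ≤ 2 ^ b / ε * (2 ^ a / ε) :=
    h1.trans_le (h3.trans (mul_le_mul_of_nonneg_left h4 (by positivity)))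
  apply Real.sqrt_le_iff.2 ⟨by positivity, h5.trans (le_of_eq ?_)⟩
  rw [← Real.rpow_natCast, ← Real.rpow_mul two_pos.le, Nat.cast_ofNat, div_mul_cancel₀ _ two_ne_zero,
    Real.rpow_add two_pos, Real.rpow_add two_pos, mul_comm (2 : ℝ) (Real.logb _ _),
    Real.rpow_mul two_pos.le, Real.rpow_logb two_pos (by norm_num) (by positivity)]
  norm_num
  field_simp

lemma smoothHmax_chain_rule [Nonempty X] [Nonempty B] {M : X × Y → Matrix B B ℂ}
    (hM : ∀ z, 0 ≤ M z) (hM1 : ∑ z, (M z).trace = 1) {ε : ℝ} (hε : 0 < ε) :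
    smoothHmax √(2 * (2 * (ε + √ε))) (cqOp M) - ((4 * Real.logb 2 (1 / ε) + 8 : ℝ) : EReal) ≤
      smoothHmax ε (marginalXB (cqOp M)) + smoothHmax ε (asYgivenXB (cqOp M)) := by
  -- For `ε ≥ 1` the smoothing radius on the left exceeds one and that side is `⊥`. Otherwise
  -- `log(1/ε) ≥ 0`, so the loss `2 log(1/ε)` is within the allowed one.
  rcases le_or_gt 1 ε with h1 | h1
  · rw [smoothHmax_eq_bot]
    · simp
    · rw [Real.one_le_sqrt]
      linarith [Real.sqrt_nonneg ε]
  have hlog : 0 ≤ Real.logb 2 (1 / ε) :=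
    Real.logb_nonneg one_lt_two ((one_le_div hε).2 h1.le)
  -- Either entropy may be `⊥`, so the bound is proved for all reals strictly above them instead of
  -- at the values themselves.
  refine EReal.le_add_of_forall_gt
    (.inr (smoothHmax_lt_top (isState_asYgivenXB hM hM1) hε.le).ne)
    (.inl (smoothHmax_lt_top (isState_marginalXB hM hM1) hε.le).ne) fun a' ha' b' hb' => ?_
  obtain ⟨a, ha, haa'⟩ := EReal.lt_iff_exists_real_btwn.1 ha'
  obtain ⟨b, hb, hbb'⟩ := EReal.lt_iff_exists_real_btwn.1 hb'
  refine le_trans ?_ (add_le_add haa'.le hbb'.le)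
  refine EReal.sub_le_of_le_add ((smoothHmax_chain_le hM hM1 hε ha hb).trans ?_)
  rw [← EReal.coe_add, ← EReal.coe_add, EReal.coe_le_coe_iff]
  linarith

end Bipartite

end CQCompression

theorem mainTheorem3 {X Y B : Type*} [Fintype X] [DecidableEq X] [Fintype Y] [DecidableEq Y]
    [Fintype B] [DecidableEq B]
    (p : X × Y → ℝ) (hp : ∀ z, 0 ≤ p z) (hp_sum : ∑ z, p z = 1)
    (φ : X × Y → Matrix B B ℂ) (hφ : ∀ z, CQCompression.IsState (φ z))
    (ψ : Matrix ((X × Y) × B) ((X × Y) × B) ℂ) (hψ : ψ = CQCompression.cqState p φ) :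
    -- the two-step protocol is a compression protocol for `XY` with controlled error
    (∀ (m n : ℕ) (encX : X → Fin m → Bool) (encY : Y → Fin n → Bool)
        (Λ : (Fin m → Bool) → X → Matrix B B ℂ)
        (Γ : (Fin n → Bool) → Y → Matrix (X × B) (X × B) ℂ) (εx εy : ℝ),
        CQCompression.IsDecoder Λ → CQCompression.IsDecoder Γ →
        CQCompression.errorProb (CQCompression.marginalXB ψ) encX Λ ≤ εx →
        CQCompression.errorProb (CQCompression.asYgivenXB ψ) encY Γ ≤ εy →
        CQCompression.IsDecoder (CQCompression.seqDecoder Λ Γ) ∧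
        CQCompression.errorProb ψ (CQCompression.seqEncoder encX encY)
          (CQCompression.seqDecoder Λ Γ) ≤ Real.sqrt (2 * εx) + εy) ∧
    -- the chain rule for smooth max-entropies
    (∀ ε ε' : ℝ, 0 < ε → ε' = 2 * (ε + Real.sqrt ε) →
      CQCompression.smoothHmax ε (CQCompression.marginalXB ψ) +
          CQCompression.smoothHmax ε (CQCompression.asYgivenXB ψ) ≥
        CQCompression.smoothHmax (Real.sqrt (2 * ε')) ψ -
          ((4 * Real.logb 2 (1 / ε) + 8 : ℝ) : EReal)) := by
  subst hψ
  have hM : ∀ z, 0 ≤ (p z : ℂ) • φ z := fun z =>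
    ((hφ z).1.smul (by exact_mod_cast hp z)).nonneg
  have hM1 : ∑ z, ((p z : ℂ) • φ z).trace = 1 := by
    simp only [Matrix.trace_smul, (hφ _).2, smul_eq_mul, mul_one]
    exact_mod_cast hp_sum
  have hM1' : ∑ z, ((p z : ℂ) • φ z).trace.re = 1 := by
    rw [← Complex.re_sum, hM1, Complex.one_re]
  obtain ⟨z⟩ : Nonempty (X × Y) := by
    by_contra h
    rw [not_nonempty_iff] at h
    simp at hp_sum
  have : Nonempty X := ⟨z.1⟩
  have : Nonempty B := by
    by_contra h
    rw [not_nonempty_iff] at h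
    simpa [Matrix.trace] using (hφ z).2
  rw [CQCompression.cqState_eq_cqOp]
  refine ⟨fun m n encX encY Λ Γ εx εy hΛ hΓ hx hy =>
    ⟨CQCompression.isDecoder_seqDecoder hΛ hΓ,
      CQCompression.errorProb_seqDecoder_le hM hM1' encX encY hΛ hΓ hx hy⟩, ?_⟩
  rintro ε _ hε rfl
  exact CQCompression.smoothHmax_chain_rule hM hM1 hε
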